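/- Let $M$ be a paracompact, connected (Hausdorff) smooth manifold of dimension $2n+1$, $n\ge 0$. Let $\mathcal D(M)$ be the $C^\infty(M)$-module of $\mathbb R$-linear differential operators of order $\le 1$ on $C^\infty(M)$, i.e. of the $\mathbb R$-linear maps $\varphi: C^\infty(M)\to C^\infty(M)$ such that $\varphi-\varphi(1)$ is a derivation, with the commutator bracket. It contains $\mathfrak X(M)$ (the derivations) and $C^\infty(M)$ (the multiplication operators); in particular $1\in\mathcal D(M)$. Let $\alpha:\mathcal D(M)\to C^\infty(M)$ be a $C^\infty(M)$-linear form and $\omega:\mathcal D(M)\times\mathcal D(M)\to C^\infty(M)$ a skew-symmetric $C^\infty(M)$-bilinear form such that $(\alpha,\omega)$ is a symplectic Lie–Rinehart–Jacobi structure on $\mathcal D(M)$. This means the following, with $\rho_\alpha:\mathcal D(M)\to\mathcal D(M)$, $\rho_\alpha(\varphi)=\varphi+\alpha(\varphi)$: 1. $(\mathcal D(M),\rho_\alpha)$ is a Lie–Rinehart algebra, i.e. $\rho_\alpha$ is a morphism of $\mathbb R$-Lie algebras and $[\varphi,f\psi]=\big(\rho_\alpha(\varphi)(f)-f\,\rho_\alpha(\varphi)(1)\big)\psi+f[\varphi,\psi]$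 for all $\varphi,\psi\in\mathcal D(M)$ and $f\in C^\infty(M)$ (equivalently, $\delta\alpha=(\delta 1)\wedge\alpha$, where $\delta$ is the Chevalley–Eilenberg operator of the identity representation of $\mathcal D(M)$ on $C^\infty(M)$); 2. $\delta_\alpha\omega=0$, where $\delta_\alpha$ is the Chevalley–Eilenberg operator of the representation $\rho_\alpha$ (equivalently, $\delta\omega=-\alpha\wedge\omega$); 3. $\omega$ is nondegenerate, i.e. $\varphi\mapsto i_\varphi\omega=\omega(\varphi,\cdot)$ is an isomorphism from $\mathcal D(M)$ onto the $C^\infty(M)$-module of linear forms on $\mathcal D(M)$. Then the differential form of degree $2n+1$ $$\big[(i_1\omega)|_{\mathfrak X(M)}\big]\wedge\big[\omega|_{\mathfrak X(M)\times\mathfrak X(M)}\big]^n$$ is a volume form on $M$, i.e. it is nonzero at every point of $M$. -/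

import Mathlib

open scoped Manifold ContDiff

noncomputable section

/-! ### Differential operators of order at most one on a commutative algebra -/

/-- The `A`-module of `K`-linear differential operators of order `≤ 1` on `A`: the `K`-linear maps
`φ : A → A` such that `φ - φ(1)` is a derivation of `A`. -/
def DiffOp (K A : Type*) [Field K] [CommRing A] [Algebra K A] :
    Submodule A (Module.End K A) where
  carrier := {φ | ∀ f g : A, φ (f * g) = f * φ g + g * φ f - f * g * φ 1}
  zero_mem' := by intro f g; simp
  add_mem' := by
    intro φ ψ hφ hψ f g
    simp only [LinearMap.add_apply, hφ f g, hψ f g]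
    ring
  smul_mem' := by
    intro a φ hφ f g
    simp only [LinearMap.smul_apply, smul_eq_mul, hφ f g]
    ring

namespace DiffOp

variable {K A : Type*} [Field K] [CommRing A] [Algebra K A]

/-- The differential operators of order `≤ 1` form a Lie algebra for the commutator. -/
instance : Bracket (DiffOp K A) (DiffOp K A) where
  bracket φ ψ := ⟨⁅(φ : Module.End K A), (ψ : Module.End K A)⁆, by
    intro f g
    obtain ⟨φ, hφ⟩ := φ
    obtain ⟨ψ, hψ⟩ := ψ
    have h1 : ∀ f g : A, φ (f * g) = f * φ g + g * φ f - f * g * φ 1 := hφ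
    have h2 : ∀ f g : A, ψ (f * g) = f * ψ g + g * ψ f - f * g * ψ 1 := hψ
    simp only [Ring.lie_def, LinearMap.sub_apply, Module.End.mul_apply, h1 f g, h2 f g,
      map_add, map_sub]
    simp only [h1 _ (_ : A), h2 _ (_ : A)]
    ring⟩

@[simp]
theorem coe_lie (φ ψ : DiffOp K A) :
    ((⁅φ, ψ⁆ : DiffOp K A) : Module.End K A) = ⁅(φ : Module.End K A), (ψ : Module.End K A)⁆ := rfl

instance : LieRing (DiffOp K A) where
  add_lie φ ψ χ := Subtype.ext (by
    simp only [coe_lie, Submodule.coe_add, Ring.lie_def]; noncomm_ring)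
  lie_add φ ψ χ := Subtype.ext (by
    simp only [coe_lie, Submodule.coe_add, Ring.lie_def]; noncomm_ring)
  lie_self φ := Subtype.ext (by simp [Ring.lie_def])
  leibniz_lie φ ψ χ := Subtype.ext (by
    simp only [coe_lie, Submodule.coe_add, Ring.lie_def, mul_sub, sub_mul, mul_assoc]; abel)

instance : LieAlgebra K (DiffOp K A) where
  lie_smul c φ ψ := Subtype.ext (by simp [Ring.lie_def, smul_sub])

/-- A function `f ∈ A`, regarded as the differential operator `g ↦ f * g` of order `0`. -/
def ofFun : A →ₗ[A] DiffOp K A where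
  toFun f := ⟨LinearMap.mulLeft K f, by
    intro g h
    simp only [LinearMap.mulLeft_apply]
    ring⟩
  map_add' f g := Subtype.ext (by ext h; simp [add_mul])
  map_smul' f g := Subtype.ext (by ext h; simp)

/-- A derivation of `A`, regarded as a differential operator of order `≤ 1`. -/
def ofDerivation : Derivation K A A →ₗ[A] DiffOp K A where
  toFun X := ⟨(X : A →ₗ[K] A), by
    intro f g
    simp⟩
  map_add' X Y := Subtype.ext (by ext h; simp)
  map_smul' a X := Subtype.ext (by ext h; simp)

end DiffOp

/-! ### Lie–Rinehart algebras, their cohomology operator, symplectic structures -/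

section LieRinehart

variable {K A G : Type*} [Field K] [CommRing A] [Algebra K A]
  [LieRing G] [LieAlgebra K G] [Module A G]

/-- `(G, ρ)` is a Lie–Rinehart algebra over `A`, with values in differential operators of
order `≤ 1`: the `A`-linear map `ρ` is a morphism of `K`-Lie algebras and
`[x, a y] = (ρ(x)(a) - a ρ(x)(1)) y + a [x, y]`. -/
structure IsLieRinehart (ρ : G →ₗ[A] DiffOp K A) : Prop where
  map_smul_base : ∀ (c : K) (x : G), ρ (c • x) = c • ρ x
  map_lie : ∀ x y : G, ρ ⁅x, y⁆ = ⁅ρ x, ρ y⁆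
  lie_smul : ∀ (x : G) (a : A) (y : G),
    ⁅x, a • y⁆ = ((ρ x : Module.End K A) a - a * (ρ x : Module.End K A) 1) • y + a • ⁅x, y⁆

/-- The cohomology operator `d_ρ` on skew-symmetric `A`-multilinear forms on `G`,
`(d_ρ η)(x₀, …, x_p) = ∑ (-1)^i ρ(x_i)(η(…, x̂_i, …))
  + ∑_{i < j} (-1)^(i + j) η([x_i, x_j], …, x̂_i, …, x̂_j, …)`.
In the second sum the pair `i < j` is written as `(i.castSucc, j.succ)` with `i ≤ j`, which accounts
for the sign in front of it. -/
def cohomologyD (ρ : G →ₗ[A] DiffOp K A) :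
    {p : ℕ} → (G [⋀^Fin p]→ₗ[A] A) → (Fin (p + 1) → G) → A
  | 0, η, x => (ρ (x 0) : Module.End K A) (η ![])
  | p + 1, η, x =>
    (∑ i : Fin (p + 2), (-1 : A) ^ (i : ℕ) * (ρ (x i) : Module.End K A) (η (i.removeNth x))) -
      ∑ i : Fin (p + 1), ∑ j ∈ Finset.Ici i, (-1 : A) ^ (i + j : ℕ) *
        η (Matrix.vecCons ⁅x i.castSucc, x j.succ⁆ (j.removeNth (i.castSucc.removeNth x)))

/-- The interior product `i_x`, `(i_x η)(x₁, …, x_p) = η(x, x₁, …, x_p)`. -/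
def interiorProd {p : ℕ} (x : G) (η : G [⋀^Fin (p + 1)]→ₗ[A] A) : G [⋀^Fin p]→ₗ[A] A :=
  η.curryLeft x

/-- A skew-symmetric bilinear form is nondegenerate if `x ↦ i_x μ` is an isomorphism from `G` onto
the module of linear forms on `G`. -/
def Form2Nondegenerate (μ : G [⋀^Fin 2]→ₗ[A] A) : Prop :=
  Function.Bijective fun x : G =>
    ((AlternatingMap.ofSubsingleton A G A (0 : Fin 1)).symm (interiorProd x μ) : Module.Dual A G)

/-- `(G, ρ, μ)` is a symplectic Lie–Rinehart–Jacobi algebra: `(G, ρ)` is a Lie–Rinehart algebra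
and `μ` is a `d_ρ`-closed nondegenerate skew-symmetric bilinear form. -/
structure IsSymplecticLieRinehartJacobi (ρ : G →ₗ[A] DiffOp K A)
    (μ : G [⋀^Fin 2]→ₗ[A] A) : Prop where
  lieRinehart : IsLieRinehart ρ
  closed : ∀ x : Fin 3 → G, cohomologyD ρ μ x = 0
  nondegenerate : Form2Nondegenerate μ

end LieRinehart

/-- The map `ρ_α : φ ↦ φ + α(φ)` on differential operators of order `≤ 1` attached to a linear
form `α`. -/
def rhoOf {K A : Type*} [Field K] [CommRing A] [Algebra K A] (α : DiffOp K A →ₗ[A] A) :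
    DiffOp K A →ₗ[A] DiffOp K A :=
  LinearMap.id + DiffOp.ofFun ∘ₗ α

/-! ### Exterior product -/

section Wedge

variable {A G : Type*} [CommRing A] [AddCommGroup G] [Module A G]

/-- The exterior product of skew-symmetric forms (sum over shuffles). -/
def wedge {p q : ℕ} (η : G [⋀^Fin p]→ₗ[A] A) (θ : G [⋀^Fin q]→ₗ[A] A) :
    G [⋀^Fin (p + q)]→ₗ[A] A :=
  ((LinearMap.mul' A A).compAlternatingMap (η.domCoprod θ)).domDomCongr finSumFinEquiv

/-- The `n`-th exterior power `Ω ∧ ⋯ ∧ Ω` of a 2-form. -/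
def wedgePow (Ω : G [⋀^Fin 2]→ₗ[A] A) : (n : ℕ) → G [⋀^Fin (2 * n)]→ₗ[A] A
  | 0 => AlternatingMap.constOfIsEmpty A G (Fin 0) 1
  | n + 1 => wedge (wedgePow Ω n) Ω

end Wedge

/-! ### Forms on a smooth manifold -/

section Manifold

variable {d : ℕ} {M : Type*} [TopologicalSpace M] [ChartedSpace (EuclideanSpace ℝ (Fin d)) M]

/-- The restriction to vector fields (the derivations of the algebra of smooth functions) of a
form defined on differential operators of order `≤ 1`. -/
def restrictToVectorFields {p : ℕ}
    (η : DiffOp ℝ C^∞⟮𝓡 d, M; ℝ⟯ [⋀^Fin p]→ₗ[C^∞⟮𝓡 d, M; ℝ⟯] C^∞⟮𝓡 d, M; ℝ⟯) :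
    Derivation ℝ C^∞⟮𝓡 d, M; ℝ⟯ C^∞⟮𝓡 d, M; ℝ⟯ [⋀^Fin p]→ₗ[C^∞⟮𝓡 d, M; ℝ⟯] C^∞⟮𝓡 d, M; ℝ⟯ :=
  η.compLinearMap DiffOp.ofDerivation

/-- A differential form on `M`, given as a skew-symmetric `C^∞(M)`-multilinear map on vector
fields, is a volume form if its degree is the dimension `d` of `M` and it is nonzero at every
point. The value of the form at `x` is `(X₁(x), …, X_p(x)) ↦ ν(X₁, …, X_p)(x)`. -/
def IsVolumeForm {p : ℕ}
    (ν : Derivation ℝ C^∞⟮𝓡 d, M; ℝ⟯ C^∞⟮𝓡 d, M; ℝ⟯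
      [⋀^Fin p]→ₗ[C^∞⟮𝓡 d, M; ℝ⟯] C^∞⟮𝓡 d, M; ℝ⟯) : Prop :=
  p = d ∧ ∀ x : M, ∃ X : Fin p → Derivation ℝ C^∞⟮𝓡 d, M; ℝ⟯ C^∞⟮𝓡 d, M; ℝ⟯, ν X x ≠ 0

end Manifold

end

/-! The statement is linear algebra in the fibre of $\mathcal D(M)$ at a point $x$, once that fibre
is known to be $\mathbb R^{2n+2}$. Bump functions and Hadamard's lemma give derivations a local
frame (`exists_local_frame`); adjoining the operator $1$ gives one for $\mathcal D(M)$
(`exists_diffOp_frame`).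

In this frame $\omega$ induces an alternating form $B$ at $x$. It is nondegenerate because each dual
frame form is some $i_\varphi\omega$. Complete $u = 1$ to a symplectic basis $u, w, v_1, \dots,
v_{2n}$ (`exists_symplectic_basis`) and subtract multiples of $u$ to make $w$ and the $v_i$ vector
fields. This leaves $i_u\omega$ unchanged, as well as $\omega$ between vectors orthogonal to $u$.
Since $i_u\omega$ is $1$ on $w$ and $0$ on the $v_i$, the top form on $(w, v)$ is $2^{-n}$ times the
signed permutation sum of the standard symplectic matrix (`map_wedge_wedgePow`), which is positive
(`pfaffianSum_stdSymplectic_pos`). -/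

noncomputable section

/-! ### Pfaffians as signed sums over permutations. -/

section Pfaffian

open Equiv

/-- Expansion of a sum over permutations of `Fin (m + 1)` along the value at `0`. -/
theorem sum_perm_fin_succ {N : Type*} [AddCommMonoid N] {m : ℕ} (f : Perm (Fin (m + 1)) → N) :
    ∑ σ, f σ = ∑ i : Fin (m + 1), ∑ τ : Perm (Fin m),
      f (i.cycleRange.symm * Perm.decomposeFin.symm (0, τ)) := by
  rw [← Fintype.sum_prod_type' (f := fun (i : Fin (m + 1)) (τ : Perm (Fin m)) =>
    f (i.cycleRange.symm * Perm.decomposeFin.symm (0, τ)))]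
  -- The second factor fixes 0 and the first sends 0 to `i`, so the product determines `i`, then
  -- `τ`. Surjectivity follows by counting.
  have hinj : Function.Injective fun q : Fin (m + 1) × Perm (Fin m) =>
      q.1.cycleRange.symm * Perm.decomposeFin.symm (0, q.2) := by
    rintro ⟨i, τ⟩ ⟨j, υ⟩ h
    have h0 : i = j := by
      have := congrArg (fun σ : Perm (Fin (m + 1)) => σ 0) h
      simpa [Fin.cycleRange_symm_zero] using this
    subst h0
    have := Perm.decomposeFin.symm.injective (mul_left_cancel h)
    simpa using this
  have hbij := (Fintype.bijective_iff_injective_and_card _).2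
    ⟨hinj, by simp [Fintype.card_perm, Nat.factorial_succ]⟩
  exact (Function.Bijective.sum_comp hbij f).symm

/-- The inverse cycle has sign `(-1) ^ i` and acts as `i.succAbove` on successors. Taking `f` on
arbitrary self-maps, not just permutations, lets the expansion be iterated. -/
theorem sum_sign_perm_fin_succ {R : Type*} [CommRing R] {m : ℕ}
    (f : (Fin (m + 1) → Fin (m + 1)) → R) :
    ∑ σ : Perm (Fin (m + 1)), ((Perm.sign σ : ℤ) : R) * f σ =
      ∑ i : Fin (m + 1), (-1) ^ (i : ℕ) * ∑ τ : Perm (Fin m), ((Perm.sign τ : ℤ) : R) *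
        f (Fin.cons i (i.succAbove ∘ τ)) := by
  rw [sum_perm_fin_succ]
  refine Finset.sum_congr rfl fun i _ => ?_
  rw [Finset.mul_sum]
  refine Finset.sum_congr rfl fun τ _ => ?_
  have h1 : (⇑(i.cycleRange.symm * Perm.decomposeFin.symm (0, τ)) : Fin (m + 1) → Fin (m + 1)) =
      Fin.cons i (i.succAbove ∘ τ) := by
    funext j
    refine Fin.cases ?_ (fun j => ?_) j
    · simp
    · simp [Perm.decomposeFin_symm_apply_succ]
  rw [h1]
  simp [Perm.sign_mul, Perm.decomposeFin.symm_sign, mul_assoc]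

/-- The signed sum `∑ sign(σ) ∏ₖ P(σ(2k), σ(2k+1))`, which is `2ⁿ n!` times the Pfaffian of `P`. -/
def pfaffianSum {R : Type*} [CommRing R] (n : ℕ) (P : Fin (2 * n) → Fin (2 * n) → R) : R :=
  ∑ σ : Perm (Fin (2 * n)), ((Perm.sign σ : ℤ) : R) *
    ∏ k : Fin n, P (σ ⟨2 * k, by omega⟩) (σ ⟨2 * k + 1, by omega⟩)

/-- Expand twice, along `σ 0` and then `σ 1`; these are the two arguments of the factor `k = 0`, and
the other factors involve only the remaining indices. -/
theorem pfaffianSum_succ {R : Type*} [CommRing R] (n : ℕ)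
    (P : Fin (2 * n + 2) → Fin (2 * n + 2) → R) :
    pfaffianSum (n + 1) P = ∑ i : Fin (2 * n + 2), ∑ j : Fin (2 * n + 1),
      (-1) ^ (i + j : ℕ) * P i (i.succAbove j) *
        pfaffianSum n fun a b => P (i.succAbove (j.succAbove a)) (i.succAbove (j.succAbove b)) := by
  unfold pfaffianSum
  refine (sum_sign_perm_fin_succ (m := 2 * n + 1) fun s => ∏ k : Fin (n + 1),
    P (s ⟨2 * k, by omega⟩) (s ⟨2 * k + 1, by omega⟩)).trans ?_
  refine Finset.sum_congr rfl fun i _ => ?_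
  refine (congrArg _ (sum_sign_perm_fin_succ (m := 2 * n) fun s => ∏ k : Fin (n + 1),
    P ((Fin.cons i (i.succAbove ∘ s) : Fin (2 * n + 2) → Fin (2 * n + 2)) ⟨2 * k, by omega⟩)
      ((Fin.cons i (i.succAbove ∘ s) : Fin (2 * n + 2) → Fin (2 * n + 2))
        ⟨2 * k + 1, by omega⟩))).trans ?_
  rw [Finset.mul_sum]
  refine Finset.sum_congr rfl fun j _ => ?_
  rw [Finset.mul_sum, Finset.mul_sum, Finset.mul_sum]
  refine Finset.sum_congr rfl fun τ _ => ?_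
  rw [Fin.prod_univ_succ]
  have h0 : P ((Fin.cons i (i.succAbove ∘ Fin.cons j (j.succAbove ∘ τ)) :
      Fin (2 * n + 2) → Fin (2 * n + 2)) ⟨2 * ((0 : Fin (n + 1)) : ℕ), by simp⟩)
      ((Fin.cons i (i.succAbove ∘ Fin.cons j (j.succAbove ∘ τ)) :
      Fin (2 * n + 2) → Fin (2 * n + 2)) ⟨2 * ((0 : Fin (n + 1)) : ℕ) + 1, by simp⟩) =
      P i (i.succAbove j) := rfl
  rw [h0, pow_add]
  have h1 : ∀ k : Fin n, P ((Fin.cons i (i.succAbove ∘ Fin.cons j (j.succAbove ∘ τ)) :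
      Fin (2 * n + 2) → Fin (2 * n + 2)) ⟨2 * (k.succ : ℕ), by have := k.succ.2; omega⟩)
      ((Fin.cons i (i.succAbove ∘ Fin.cons j (j.succAbove ∘ τ)) :
      Fin (2 * n + 2) → Fin (2 * n + 2)) ⟨2 * (k.succ : ℕ) + 1, by have := k.succ.2; omega⟩) =
      P (i.succAbove (j.succAbove (τ ⟨2 * k, by omega⟩)))
        (i.succAbove (j.succAbove (τ ⟨2 * k + 1, by omega⟩))) := fun k => rfl
  rw [Finset.prod_congr rfl fun k _ => h1 k]
  ring

/-- The entries of the standard symplectic matrix, for the ordering of the basis in which the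
conjugate vectors are consecutive. -/
def stdSymplectic (i j : ℕ) : ℝ :=
  if i % 2 = 0 ∧ j = i + 1 then 1 else if j % 2 = 0 ∧ i = j + 1 then -1 else 0

/-- In the expansion only conjugate pairs `{2k, 2k+1}` contribute. For either order `j = 2k`, so the
sign cancels that of the entry, and deleting the pair leaves the standard matrix of smaller size.
Hence there is no cancellation. -/
theorem pfaffianSum_stdSymplectic_pos (n : ℕ) :
    0 < pfaffianSum n fun a b => stdSymplectic a b := by
  induction n with
  | zero => simp [pfaffianSum]
  | succ n ih =>
    rw [pfaffianSum_succ]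
    have key : ∀ (i : Fin (2 * n + 2)) (j : Fin (2 * n + 1)),
        stdSymplectic i (i.succAbove j) ≠ 0 →
        (-1 : ℝ) ^ (i + j : ℕ) * stdSymplectic i (i.succAbove j) *
        (pfaffianSum n fun a b => stdSymplectic (i.succAbove (j.succAbove a))
          (i.succAbove (j.succAbove b))) = pfaffianSum n fun a b => stdSymplectic a b := by
      intro i j hij
      have hs : ∀ {m : ℕ} (i : Fin (m + 1)) (a : Fin m),
          ((i.succAbove a : Fin (m + 1)) : ℕ) = if (a : ℕ) < i then (a : ℕ) else a + 1 := by
        intro m i a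
        simp only [Fin.succAbove, Fin.lt_def, Fin.val_castSucc]
        split_ifs <;> simp
      have h1 : (-1 : ℝ) ^ (i + j : ℕ) * stdSymplectic i (i.succAbove j) = 1 := by
        unfold stdSymplectic at hij ⊢
        rw [hs] at hij ⊢
        split_ifs at hij ⊢ with h1 h2 h3 h4 <;> try omega
        all_goals first
          | (rw [Even.neg_one_pow (by rw [Nat.even_iff]; omega)]; norm_num)
          | (rw [Odd.neg_one_pow (by rw [Nat.odd_iff]; omega)]; norm_num)
          | (exfalso; exact hij rfl)
      have h2 : ∀ a b : Fin (2 * n), stdSymplectic (i.succAbove (j.succAbove a))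
          (i.succAbove (j.succAbove b)) = stdSymplectic a b := by
        intro a b
        have hij' : ∃ k, (i : ℕ) ≤ 2 * k + 1 ∧ 2 * k ≤ i ∧ (j : ℕ) = 2 * k := by
          refine ⟨i / 2, by omega, by omega, ?_⟩
          unfold stdSymplectic at hij
          rw [hs] at hij
          split_ifs at hij <;> first | omega | (exfalso; exact hij rfl)
        obtain ⟨k, hk1, hk2, hk3⟩ := hij'
        -- Indices beyond the deleted pair move by 2, which preserves parity and adjacency within
        -- pairs.
        have hv : ∀ a : Fin (2 * n), ((i.succAbove (j.succAbove a) : Fin _) : ℕ) =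
            if (a : ℕ) < 2 * k then (a : ℕ) else a + 2 := by
          intro a
          rw [hs, hs]
          split_ifs <;> omega
        unfold stdSymplectic
        rw [hv, hv]
        split_ifs <;> first | rfl | omega
      rw [h1, one_mul]
      simp only [h2]
    have hterm : ∀ (i : Fin (2 * n + 2)) (j : Fin (2 * n + 1)), 0 ≤
        (-1 : ℝ) ^ (i + j : ℕ) * stdSymplectic i (i.succAbove j) *
        (pfaffianSum n fun a b => stdSymplectic (i.succAbove (j.succAbove a))
          (i.succAbove (j.succAbove b))) := by
      intro i j
      by_cases h : stdSymplectic i (i.succAbove j) = 0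
      · simp [h]
      · rw [key i j h]; exact ih.le
    refine Finset.sum_pos' (fun i _ => Finset.sum_nonneg fun j _ => hterm i j)
      ⟨0, Finset.mem_univ _, Finset.sum_pos' (fun j _ => hterm 0 j) ⟨0, Finset.mem_univ _, ?_⟩⟩
    rw [key 0 0 (by simp [stdSymplectic])]
    exact ih

/-! ### Exterior products as alternations of plain products. -/

section Wedge

variable {A G : Type*} [CommRing A] [AddCommGroup G] [Module A G]

/-- The product of two multilinear forms in separate variables. -/
def mulForms {p q : ℕ} (a : MultilinearMap A (fun _ : Fin p => G) A)
    (b : MultilinearMap A (fun _ : Fin q => G) A) :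
    MultilinearMap A (fun _ : Fin (p + q) => G) A :=
  ((LinearMap.mul' A A).compMultilinearMap (a.domCoprod b)).domDomCongr finSumFinEquiv

theorem mulForms_apply {p q : ℕ} (a : MultilinearMap A (fun _ : Fin p => G) A)
    (b : MultilinearMap A (fun _ : Fin q => G) A) (v : Fin (p + q) → G) :
    mulForms a b v = a (fun i => v (Fin.castAdd q i)) * b (fun i => v (Fin.natAdd p i)) := by
  simp [mulForms, MultilinearMap.domDomCongr_apply]

/-- A permutation of all the variables is a shuffle combined with a permutation of each block. What
remains is transport along `finSumFinEquiv`. -/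
theorem alternatization_mulForms {p q : ℕ} (a : MultilinearMap A (fun _ : Fin p => G) A)
    (b : MultilinearMap A (fun _ : Fin q => G) A) :
    MultilinearMap.alternatization (mulForms a b) =
      wedge (MultilinearMap.alternatization a) (MultilinearMap.alternatization b) := by
  unfold wedge
  rw [← MultilinearMap.domCoprod_alternization]
  ext v
  simp only [MultilinearMap.alternatization_apply, AlternatingMap.domDomCongr_apply,
    LinearMap.compAlternatingMap_apply, map_sum, mulForms, MultilinearMap.domDomCongr_apply]
  refine (Fintype.sum_equiv (finSumFinEquiv.permCongr) _ _ fun σ => ?_).symm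
  simp only [Perm.sign_permCongr, Units.smul_def, map_zsmul]
  congr 1
  simp

/-- The multilinear form `(v₀, v₁, …) ↦ Ω(v₀, v₁) Ω(v₂, v₃) ⋯`. -/
def mulPow (Ω : G [⋀^Fin 2]→ₗ[A] A) : (n : ℕ) → MultilinearMap A (fun _ : Fin (2 * n) => G) A
  | 0 => (MultilinearMap.constOfIsEmpty A (fun _ : Fin 0 => G) 1 :
      MultilinearMap A (fun _ : Fin 0 => G) A)
  | n + 1 => mulForms (mulPow Ω n) (Ω : MultilinearMap A (fun _ : Fin 2 => G) A)

theorem mulPow_apply (Ω : G [⋀^Fin 2]→ₗ[A] A) (n : ℕ) (v : Fin (2 * n) → G) :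
    mulPow Ω n v = ∏ k : Fin n, Ω ![v ⟨2 * k, by omega⟩, v ⟨2 * k + 1, by omega⟩] := by
  induction n with
  | zero => exact (Fin.prod_univ_zero _).symm
  | succ n ih =>
    rw [Fin.prod_univ_castSucc]
    refine (mulForms_apply _ _ v).trans ?_
    rw [ih]
    congr 1
    refine congrArg Ω ?_
    funext i
    fin_cases i <;> rfl

theorem wedge_smul_left {p q : ℕ} (c : ℕ) (a : G [⋀^Fin p]→ₗ[A] A) (b : G [⋀^Fin q]→ₗ[A] A) :
    wedge (c • a) b = c • wedge a b := by
  unfold wedge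
  rw [← AlternatingMap.domCoprod'_apply, ← TensorProduct.smul_tmul', map_nsmul,
    AlternatingMap.domCoprod'_apply]
  ext v
  simp

theorem wedge_smul_right {p q : ℕ} (c : ℕ) (a : G [⋀^Fin p]→ₗ[A] A) (b : G [⋀^Fin q]→ₗ[A] A) :
    wedge a (c • b) = c • wedge a b := by
  unfold wedge
  rw [← AlternatingMap.domCoprod'_apply, TensorProduct.tmul_smul, map_nsmul,
    AlternatingMap.domCoprod'_apply]
  ext v
  simp

/-- Alternating a form of degree 2 that is already alternating multiplies it by 2!, once per factor.
-/
theorem alternatization_mulPow (Ω : G [⋀^Fin 2]→ₗ[A] A) (n : ℕ) :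
    MultilinearMap.alternatization (mulPow Ω n) = 2 ^ n • wedgePow Ω n := by
  induction n with
  | zero =>
    refine AlternatingMap.ext fun v => ?_
    refine (MultilinearMap.alternatization_apply (ι := Fin 0) _ v).trans ?_
    rw [Fintype.sum_unique]
    simp [mulPow, wedgePow]
  | succ n ih =>
    refine (alternatization_mulForms _ _).trans ?_
    rw [ih, wedge_smul_left, AlternatingMap.coe_alternatization, wedge_smul_right, smul_smul]
    simp [pow_succ, wedgePow]

theorem two_pow_smul_wedge_wedgePow (θ : G [⋀^Fin 1]→ₗ[A] A) (Ω : G [⋀^Fin 2]→ₗ[A] A) (n : ℕ) :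
    2 ^ n • wedge θ (wedgePow Ω n) = MultilinearMap.alternatization
      (mulForms (θ : MultilinearMap A (fun _ : Fin 1 => G) A) (mulPow Ω n)) := by
  rw [alternatization_mulForms, alternatization_mulPow, AlternatingMap.coe_alternatization,
    wedge_smul_right]
  simp

/-- If `θ(v₀) = 1` and `θ(vᵢ) = 0` for `i > 0`, the value of `θ ∧ Ωⁿ` on `v` is, up to a factor, a
Pfaffian. Everything is evaluated through a ring morphism `e`. -/
theorem map_wedge_wedgePow {R : Type*} [CommRing R] (e : A →+* R) (θ : G [⋀^Fin 1]→ₗ[A] A)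
    (Ω : G [⋀^Fin 2]→ₗ[A] A) (n : ℕ) (v₀ : G) (v : Fin (2 * n) → G)
    (h₀ : e (θ ![v₀]) = 1) (hv : ∀ i, e (θ ![v i]) = 0) :
    2 ^ n * e (wedge θ (wedgePow Ω n) (fun i => (Fin.cons v₀ v : Fin (2 * n + 1) → G)
      (Fin.cast (Nat.add_comm _ _) i))) =
      pfaffianSum n fun a b => e (Ω ![v a, v b]) := by
  set w : Fin (1 + 2 * n) → G := fun i => (Fin.cons v₀ v : Fin (2 * n + 1) → G)
      (Fin.cast (Nat.add_comm _ _) i) with hw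
  have h := congrArg (fun η => e (η w)) (two_pow_smul_wedge_wedgePow θ Ω n)
  simp only [AlternatingMap.smul_apply, MultilinearMap.alternatization_apply, map_sum,
    MultilinearMap.domDomCongr_apply, mulForms_apply, mulPow_apply, nsmul_eq_mul, map_mul,
    Units.smul_def, zsmul_eq_mul, map_intCast, Nat.cast_pow, map_pow] at h
  simp only [Nat.cast_ofNat, map_ofNat, AlternatingMap.coe_multilinearMap, map_prod] at h
  rw [h]
  have hperm := Fintype.sum_equiv ((finCongr (Nat.add_comm 1 (2 * n))).permCongr)
    (fun σ : Perm (Fin (1 + 2 * n)) => ((Perm.sign σ : ℤ) : R) *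
      (e (θ fun i => w (σ (Fin.castAdd (2 * n) i))) * ∏ k : Fin n,
        e (Ω ![w (σ (Fin.natAdd 1 ⟨2 * k, by omega⟩)),
          w (σ (Fin.natAdd 1 ⟨2 * k + 1, by omega⟩))])))
    (fun σ : Perm (Fin (2 * n + 1)) => ((Perm.sign σ : ℤ) : R) *
      (fun s : Fin (2 * n + 1) → Fin (2 * n + 1) =>
        e (θ ![(Fin.cons v₀ v : Fin (2 * n + 1) → G) (s 0)]) * ∏ k : Fin n,
        e (Ω ![(Fin.cons v₀ v : Fin (2 * n + 1) → G) (s (Fin.succ ⟨2 * k, by omega⟩)),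
          (Fin.cons v₀ v : Fin (2 * n + 1) → G) (s (Fin.succ ⟨2 * k + 1, by omega⟩))])) σ)
    (fun σ => by
      rw [Perm.sign_permCongr]
      have hw' : ∀ a : Fin (2 * n), w (σ (Fin.natAdd 1 a)) = (Fin.cons v₀ v : Fin (2 * n + 1) → G)
          ((finCongr (Nat.add_comm 1 (2 * n))).permCongr σ a.succ) := by
        intro a
        have : (finCongr (Nat.add_comm 1 (2 * n))).symm a.succ = Fin.natAdd 1 a :=
          Fin.ext (by simp [Nat.add_comm])
        rw [Equiv.permCongr_apply, this]
        rfl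
      simp only [hw']
      refine congrArg (fun t => _ * (e (θ t) * _)) ?_
      funext i
      fin_cases i
      rfl)
  refine hperm.trans ?_
  refine (sum_sign_perm_fin_succ (m := 2 * n) (fun s : Fin (2 * n + 1) → Fin (2 * n + 1) =>
        e (θ ![(Fin.cons v₀ v : Fin (2 * n + 1) → G) (s 0)]) * ∏ k : Fin n,
        e (Ω ![(Fin.cons v₀ v : Fin (2 * n + 1) → G) (s (Fin.succ ⟨2 * k, by omega⟩)),
          (Fin.cons v₀ v : Fin (2 * n + 1) → G) (s (Fin.succ ⟨2 * k + 1, by omega⟩))]))).trans ?_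
  -- Every permutation moving 0 contributes a factor `θ(vᵢ) = 0`.
  rw [Fin.sum_univ_succ, Finset.sum_eq_zero (s := Finset.univ) (f := fun i : Fin (2 * n) => _)]
  · simp only [Fin.cons_zero, h₀, Fin.cons_succ, Function.comp_apply, Fin.zero_succAbove]
    simp [pfaffianSum]
  · intro i _
    simp [hv]

end Wedge

end Pfaffian

/-! ### Symplectic linear algebra. -/

/-- In a symplectic vector space every nonzero vector is the first vector of a symplectic basis. -/
theorem exists_symplectic_basis (n : ℕ) : ∀ {V : Type} [AddCommGroup V] [Module ℝ V]
    [FiniteDimensional ℝ V] (B : V →ₗ[ℝ] V →ₗ[ℝ] ℝ), B.IsAlt →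
    (∀ x, (∀ y, B x y = 0) → x = 0) → Module.finrank ℝ V = 2 * n + 2 → ∀ u : V, u ≠ 0 →
    ∃ (w : V) (v : Fin (2 * n) → V), B u w = 1 ∧ (∀ i, B u (v i) = 0) ∧ (∀ i, B w (v i) = 0) ∧
      ∀ i j, B (v i) (v j) = stdSymplectic i j := by
  induction n with
  | zero =>
    intro V _ _ _ B hB hn hV u hu
    obtain ⟨y, hy⟩ : ∃ y, B u y ≠ 0 := by
      by_contra! h
      exact hu (hn u h)
    exact ⟨(B u y)⁻¹ • y, fun i => i.elim0, by simp [hy], fun i => i.elim0, fun i => i.elim0,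
      fun i => i.elim0⟩
  | succ n ih =>
    intro V _ _ _ B hB hn hV u hu
    obtain ⟨y, hy⟩ : ∃ y, B u y ≠ 0 := by
      by_contra! h
      exact hu (hn u h)
    obtain ⟨w, hw⟩ : ∃ w, B u w = 1 := ⟨(B u y)⁻¹ • y, by simp [hy]⟩
    have hneg : ∀ a b, B a b = - B b a := fun a b => by rw [hB.neg]
    have hwu : B w u = -1 := by rw [hneg, hw]
    have huu : B u u = 0 := hB u
    have hww : B w w = 0 := hB w
    -- The kernel of `L` is the orthogonal complement of the hyperbolic plane spanned by `u` and
    -- `w`; the induction continues there.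
    set L : V →ₗ[ℝ] ℝ × ℝ := (B u).prod (B w) with hL
    have hsurj : Function.Surjective L := by
      rintro ⟨a, b⟩
      refine ⟨a • w - b • u, ?_⟩
      simp [hL, hw, hwu, huu, hww]
    have hrank : Module.finrank ℝ (LinearMap.ker L) = 2 * n + 2 := by
      have h1 := LinearMap.finrank_range_add_finrank_ker L
      rw [LinearMap.range_eq_top.2 hsurj, finrank_top, Module.finrank_prod, Module.finrank_self]
        at h1
      omega
    have hker : ∀ z : LinearMap.ker L, B u z = 0 ∧ B w z = 0 := by
      intro z
      have := z.2
      rw [LinearMap.mem_ker] at this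
      exact ⟨congrArg Prod.fst this, congrArg Prod.snd this⟩
    obtain ⟨u', hu'⟩ : ∃ u' : LinearMap.ker L, u' ≠ 0 := by
      have : Nontrivial (LinearMap.ker L) := Module.nontrivial_of_finrank_pos (R := ℝ) (by omega)
      exact exists_ne 0
    obtain ⟨w', v', h1, h2, h3, h4⟩ := ih (B.domRestrict₁₂ (LinearMap.ker L) (LinearMap.ker L))
      (fun x => hB x) (by
        intro x hx
        refine Subtype.ext (hn x fun y => ?_)
        -- This is the projection of `y` along the plane. It has the same pairing with `x`, which is
        -- orthogonal to `u` and `w`.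
        have hy' : y - B u y • w + B w y • u ∈ LinearMap.ker L := by
          rw [LinearMap.mem_ker]
          simp [hL, hw, hwu, huu, hww]
        have := hx ⟨_, hy'⟩
        simp only [LinearMap.domRestrict₁₂_apply, map_add, map_sub, map_smul] at this
        rw [hneg x w, hneg x u, (hker x).1, (hker x).2] at this
        simpa using this) hrank u' hu'
    simp only [LinearMap.domRestrict₁₂_apply] at h1 h2 h3 h4
    refine ⟨w, Fin.cons (u' : V) (Fin.cons (w' : V) fun i => (v' i : V)), hw, ?_, ?_, ?_⟩
    · exact Fin.cases (hker _).1 (Fin.cases (hker _).1 fun i => (hker _).1)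
    · exact Fin.cases (hker _).2 (Fin.cases (hker _).2 fun i => (hker _).2)
    · have e0 : ∀ (a : ℕ), stdSymplectic 0 (a + 2) = 0 ∧ stdSymplectic 1 (a + 2) = 0 ∧
          stdSymplectic (a + 2) 0 = 0 ∧ stdSymplectic (a + 2) 1 = 0 := by
        intro a
        refine ⟨?_, ?_, ?_, ?_⟩ <;> rw [stdSymplectic, if_neg (by omega), if_neg (by omega)]
      have e1 : ∀ a b : ℕ, stdSymplectic (a + 2) (b + 2) = stdSymplectic a b := by
        intro a b
        unfold stdSymplectic
        split_ifs <;> first | rfl | omega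
      have s00 : stdSymplectic 0 0 = 0 := by simp [stdSymplectic]
      have s01 : stdSymplectic 0 1 = 1 := by simp [stdSymplectic]
      have s10 : stdSymplectic 1 0 = -1 := by simp [stdSymplectic]
      have s11 : stdSymplectic 1 1 = 0 := by simp [stdSymplectic]
      intro i j
      refine Fin.cases ?_ (fun i => Fin.cases ?_ (fun i => ?_) i) i
      · refine Fin.cases ?_ (fun j => Fin.cases ?_ (fun j => ?_) j) j
        · exact (hB u').trans s00.symm
        · exact h1.trans s01.symm
        · exact (h2 j).trans (e0 j).1.symm
      · refine Fin.cases ?_ (fun j => Fin.cases ?_ (fun j => ?_) j) j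
        · exact (hneg w' u').trans ((congrArg Neg.neg h1).trans s10.symm)
        · exact (hB w').trans s11.symm
        · exact (h3 j).trans (e0 j).2.1.symm
      · refine Fin.cases ?_ (fun j => Fin.cases ?_ (fun j => ?_) j) j
        · exact (hneg (v' i) u').trans ((congrArg Neg.neg (h2 i)).trans
            (neg_zero.trans (e0 i).2.2.1.symm))
        · exact (hneg (v' i) w').trans ((congrArg Neg.neg (h3 i)).trans
            (neg_zero.trans (e0 i).2.2.2.symm))
        · exact (h4 i j).trans (e1 i j).symm

/-! ### Smooth parameter integrals and Hadamard's lemma. -/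

-- The integral is the value at 0 of the convolution of the indicator of `(0, 1]` with `s ↦ ψ(s)
-- H(q, -s)`. The cutoff `ψ` supplies compact support and equals 1 on the range of integration, so
-- smoothness of convolutions with parameters applies.
open MeasureTheory in
theorem contDiff_integral_zero_one {E E' : Type*} [NormedAddCommGroup E] [NormedSpace ℝ E]
    [NormedAddCommGroup E'] [NormedSpace ℝ E'] {H : E → ℝ → E'}
    (hH : ContDiff ℝ ∞ (fun q : E × ℝ => H q.1 q.2)) :
    ContDiff ℝ ∞ fun q => ∫ t in (0 : ℝ)..1, H q t := by
  let ψ : ContDiffBump (0 : ℝ) := ⟨1, 2, one_pos, one_lt_two⟩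
  let f : ℝ → ℝ := (Set.Ioc (0 : ℝ) 1).indicator fun _ => 1
  let g : E → ℝ → E' := fun q s => ψ s • H q (-s)
  have hf : LocallyIntegrable f volume :=
    ((integrable_indicator_iff measurableSet_Ioc).2
      (integrableOn_const (by simp))).locallyIntegrable
  have hg : ContDiff ℝ ∞ (↿g) := by
    refine (ψ.contDiff.comp contDiff_snd).smul ?_
    exact hH.comp (contDiff_fst.prodMk contDiff_snd.neg)
  have h := contDiffOn_convolution_right_with_param (n := ⊤) (μ := volume) (f := f) (g := g)
    (ContinuousLinearMap.lsmul ℝ ℝ) (s := Set.univ) (k := Metric.closedBall 0 2) isOpen_univ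
    (isCompact_closedBall _ _) (by
      intro p x _ hx
      have : ψ x = 0 := ψ.zero_of_le_dist (by
        simp only [Metric.mem_closedBall, not_le] at hx
        exact hx.le)
      simp [g, this]) hf hg.contDiffOn
  rw [Set.univ_prod_univ, contDiffOn_univ] at h
  have h2 := h.comp (contDiff_id.prodMk (contDiff_const (c := (0 : ℝ))) :
    ContDiff ℝ ∞ fun q : E => (q, (0 : ℝ)))
  convert h2 using 1
  funext q
  simp only [Function.comp_apply, convolution, id]
  rw [intervalIntegral.integral_of_le zero_le_one, ← integral_indicator measurableSet_Ioc]
  refine integral_congr_ae (μ := volume) (Filter.Eventually.of_forall fun t => ?_)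
  by_cases ht : t ∈ Set.Ioc (0 : ℝ) 1
  · have : ψ (-t) = 1 := ψ.one_of_mem_closedBall (by
      simp only [Metric.mem_closedBall, dist_zero_right, norm_neg, Real.norm_eq_abs]
      rw [abs_of_pos ht.1]; exact ht.2)
    simp [f, g, ht, this]
  · simp [f, ht]

/-- Hadamard's lemma. -/
theorem exists_contDiff_hadamard {E : Type*} [NormedAddCommGroup E] [NormedSpace ℝ E]
    {F : E → ℝ} (hF : ContDiff ℝ ∞ F) (p : E) :
    ∃ G : E → E →L[ℝ] ℝ, ContDiff ℝ ∞ G ∧ (∀ q, F q = F p + G q (q - p)) ∧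
      G p = fderiv ℝ F p := by
  have hF' : ContDiff ℝ ∞ (fderiv ℝ F) := hF.fderiv_right le_rfl
  -- Average the derivative over the segment from `p` to `q`.
  refine ⟨fun q => ∫ t in (0 : ℝ)..1, fderiv ℝ F (p + t • (q - p)), ?_, ?_, ?_⟩
  · refine contDiff_integral_zero_one ?_
    exact hF'.comp (by fun_prop)
  · intro q
    have hline : ∀ t : ℝ, HasDerivAt (fun t : ℝ => p + t • (q - p)) (q - p) t := fun t => by
      simpa using ((hasDerivAt_id t).smul_const (q - p)).const_add p
    have hd : ∀ t : ℝ, HasDerivAt (fun t : ℝ => F (p + t • (q - p)))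
        (fderiv ℝ F (p + t • (q - p)) (q - p)) t := fun t =>
      ((hF.differentiable (by simp)) _).hasFDerivAt.comp_hasDerivAt t (hline t)
    have hcont : Continuous fun t : ℝ => fderiv ℝ F (p + t • (q - p)) :=
      hF'.continuous.comp (by fun_prop)
    have h := intervalIntegral.integral_eq_sub_of_hasDerivAt (a := 0) (b := 1)
      (fun t _ => hd t) ((hcont.clm_apply continuous_const).intervalIntegrable _ _)
    rw [ContinuousLinearMap.intervalIntegral_apply (hcont.intervalIntegrable _ _), h]
    simp
  · simp

/-! ### Local frames of derivations. -/

section LocalFrame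

open Topology

theorem contMDiffMap_sum_apply {d : ℕ} {M ι : Type*} [TopologicalSpace M]
    [ChartedSpace (EuclideanSpace ℝ (Fin d)) M] (s : Finset ι) (h : ι → C^∞⟮𝓡 d, M; ℝ⟯) (z : M) :
    (∑ i ∈ s, h i) z = ∑ i ∈ s, h i z :=
  map_sum (ContMDiffMap.evalRingHom z) _ _

variable {d : ℕ} {M : Type*} [TopologicalSpace M]
  [ChartedSpace (EuclideanSpace ℝ (Fin d)) M] [IsManifold (𝓡 d) ∞ M] {x : M}

theorem contMDiffOn_comp_extChartAt {g : EuclideanSpace ℝ (Fin d) → ℝ}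
    (hg : ContDiffOn ℝ ∞ g (extChartAt (𝓡 d) x).target) :
    ContMDiffOn (𝓡 d) 𝓘(ℝ, ℝ) ∞ (fun z => g (extChartAt (𝓡 d) x z))
      (chartAt (EuclideanSpace ℝ (Fin d)) x).source :=
  hg.contMDiffOn.comp contMDiffOn_extChartAt fun z hz =>
    (extChartAt (𝓡 d) x).map_source (by rwa [extChartAt_source])

theorem contDiffOn_comp_extChartAt_symm (f : C^∞⟮𝓡 d, M; ℝ⟯) :
    ContDiffOn ℝ ∞ (fun q => f ((extChartAt (𝓡 d) x).symm q)) (extChartAt (𝓡 d) x).target :=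
  contMDiffOn_iff_contDiffOn.1
    (f.contMDiff.comp_contMDiffOn (contMDiffOn_extChartAt_symm x))

theorem contDiffOn_fderiv_comp_extChartAt_symm (f : C^∞⟮𝓡 d, M; ℝ⟯)
    (v : EuclideanSpace ℝ (Fin d)) :
    ContDiffOn ℝ ∞ (fun q => fderiv ℝ (fun q => f ((extChartAt (𝓡 d) x).symm q)) q v)
      (extChartAt (𝓡 d) x).target :=
  ((contDiffOn_comp_extChartAt_symm f).fderiv_of_isOpen (isOpen_extChartAt_target x)
    le_rfl).clm_apply contDiffOn_const

theorem differentiableAt_comp_extChartAt_symm (f : C^∞⟮𝓡 d, M; ℝ⟯) {z : M}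
    (hz : z ∈ (extChartAt (𝓡 d) x).source) :
    DifferentiableAt ℝ (fun q => f ((extChartAt (𝓡 d) x).symm q)) (extChartAt (𝓡 d) x z) :=
  ((contDiffOn_comp_extChartAt_symm f).differentiableOn (by simp)).differentiableAt
    ((isOpen_extChartAt_target x).mem_nhds ((extChartAt (𝓡 d) x).map_source hz))

variable [T2Space M]

/-- A function which is smooth on a chart, multiplied by a bump function. -/
def bumpMul (b : SmoothBumpFunction (𝓡 d) x) (g : M → ℝ)
    (hg : ContMDiffOn (𝓡 d) 𝓘(ℝ, ℝ) ∞ g (chartAt (EuclideanSpace ℝ (Fin d)) x).source) :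
    C^∞⟮𝓡 d, M; ℝ⟯ :=
  ⟨fun z => b z • g z, b.contMDiff_smul hg⟩

@[simp]
theorem bumpMul_apply (b : SmoothBumpFunction (𝓡 d) x) (g : M → ℝ)
    (hg : ContMDiffOn (𝓡 d) 𝓘(ℝ, ℝ) ∞ g (chartAt (EuclideanSpace ℝ (Fin d)) x).source) (z : M) :
    bumpMul b g hg z = b z * g z := rfl

/-- The derivative in the direction `v` in a chart, multiplied by a bump function. -/
def chartDerivation (b : SmoothBumpFunction (𝓡 d) x) (v : EuclideanSpace ℝ (Fin d)) :
    Derivation ℝ C^∞⟮𝓡 d, M; ℝ⟯ C^∞⟮𝓡 d, M; ℝ⟯ :=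
  Derivation.mk'
    { toFun := fun f => bumpMul b (fun z => fderiv ℝ (fun q => f ((extChartAt (𝓡 d) x).symm q))
        (extChartAt (𝓡 d) x z) v)
          (contMDiffOn_comp_extChartAt (contDiffOn_fderiv_comp_extChartAt_symm f v))
      map_add' := fun f g => by
        ext z
        by_cases hz : z ∈ (extChartAt (𝓡 d) x).source
        · simp only [bumpMul_apply, ContMDiffMap.coe_add, Pi.add_apply]
          rw [fderiv_fun_add (differentiableAt_comp_extChartAt_symm f hz)
            (differentiableAt_comp_extChartAt_symm g hz)]
          simp [mul_add]
        · have : b z = 0 := by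
            by_contra h
            exact hz (by simpa using b.support_subset_source h)
          simp [this]
      map_smul' := fun c f => by
        ext z
        by_cases hz : z ∈ (extChartAt (𝓡 d) x).source
        · simp only [bumpMul_apply, ContMDiffMap.coe_smul, Pi.smul_apply, RingHom.id_apply]
          rw [fderiv_fun_const_smul (differentiableAt_comp_extChartAt_symm f hz)]
          simp [mul_left_comm]
        · have : b z = 0 := by
            by_contra h
            exact hz (by simpa using b.support_subset_source h)
          simp [this] }
    fun f g => by
      ext z
      by_cases hz : z ∈ (extChartAt (𝓡 d) x).source
      · simp only [LinearMap.coe_mk, AddHom.coe_mk, bumpMul_apply, ContMDiffMap.coe_add,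
          ContMDiffMap.coe_mul, Pi.add_apply, Pi.mul_apply, smul_eq_mul]
        rw [fderiv_fun_mul (differentiableAt_comp_extChartAt_symm f hz)
            (differentiableAt_comp_extChartAt_symm g hz)]
        simp only [(extChartAt (𝓡 d) x).left_inv hz]
        simp
        ring
      · have : b z = 0 := by
          by_contra h
          exact hz (by simpa using b.support_subset_source h)
        simp [this]

theorem chartDerivation_apply (b : SmoothBumpFunction (𝓡 d) x) (v : EuclideanSpace ℝ (Fin d))
    (f : C^∞⟮𝓡 d, M; ℝ⟯) (z : M) :
    chartDerivation b v f z = b z * fderiv ℝ (fun q => f ((extChartAt (𝓡 d) x).symm q))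
        (extChartAt (𝓡 d) x z) v := rfl

/-- A smooth function of the chart, multiplied by a bump function. -/
def chartFunction (b : SmoothBumpFunction (𝓡 d) x) (g : EuclideanSpace ℝ (Fin d) → ℝ)
    (hg : ContDiff ℝ ∞ g) : C^∞⟮𝓡 d, M; ℝ⟯ :=
  bumpMul b (fun z => g (extChartAt (𝓡 d) x z)) (contMDiffOn_comp_extChartAt hg.contDiffOn)

/-- A coordinate of the chart, multiplied by a bump function. -/
def chartCoord (b : SmoothBumpFunction (𝓡 d) x) (i : Fin d) : C^∞⟮𝓡 d, M; ℝ⟯ :=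
  chartFunction b (fun q => q i) (by fun_prop)

/-- Derivations are local: a bump function `c` supported where `f = g` gives `c * (f - g) = 0`, and
Leibniz at `z` isolates `X (f - g) z`. -/
theorem derivation_congr (X : Derivation ℝ C^∞⟮𝓡 d, M; ℝ⟯ C^∞⟮𝓡 d, M; ℝ⟯)
    {f g : C^∞⟮𝓡 d, M; ℝ⟯} {z : M} (h : ⇑f =ᶠ[𝓝 z] g) : X f z = X g z := by
  obtain ⟨χ, hχ⟩ : ∃ χ : SmoothBumpFunction (𝓡 d) z, Function.support χ ⊆ {y | f y = g y} := by
    obtain ⟨χ, -, hχ⟩ := (SmoothBumpFunction.nhds_basis_support (I := 𝓡 d) (c := z)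
      Filter.univ_mem).mem_iff.1 h
    exact ⟨χ, hχ⟩
  let c : C^∞⟮𝓡 d, M; ℝ⟯ := ⟨χ, χ.contMDiff⟩
  have hc : c * (f - g) = 0 := by
    ext y
    by_cases hy : χ y = 0
    · exact (congrArg (· * _) hy).trans (zero_mul _)
    · have : f y = g y := hχ hy
      simp [this]
  have h1 : X (c * (f - g)) z = 0 := by rw [hc, map_zero]; rfl
  rw [X.leibniz] at h1
  have hc1 : c z = 1 := χ.eq_one
  have hz : f z = g z := h.eq_of_nhds
  simp only [ContMDiffMap.coe_add, Pi.add_apply, smul_eq_mul, ContMDiffMap.coe_mul, Pi.mul_apply,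
    ContMDiffMap.coe_sub, Pi.sub_apply, hc1, hz, map_sub] at h1
  linarith

/-- Where the bump function is `1`, a derivation is a combination of the chart derivations. -/
theorem derivation_apply_eq_sum (b : SmoothBumpFunction (𝓡 d) x)
    (X : Derivation ℝ C^∞⟮𝓡 d, M; ℝ⟯ C^∞⟮𝓡 d, M; ℝ⟯) (f : C^∞⟮𝓡 d, M; ℝ⟯) {z : M}
    (hz : ∀ᶠ y in 𝓝 z, b y = 1) :
    X f z = ∑ i, X (chartCoord b i) z *
      chartDerivation b (EuclideanSpace.single i 1) f z := by
  set φ := extChartAt (𝓡 d) x with hφ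
  have hbz : b z = 1 := hz.self_of_nhds
  have hzs : z ∈ φ.source := by
    have : z ∈ Function.support b := by simp [hbz]
    simpa [hφ] using b.support_subset_source this
  set p := φ z with hp
  have hpt : p ∈ φ.target := φ.map_source hzs
  obtain ⟨r, hr, hrt⟩ := Metric.isOpen_iff.1 (isOpen_extChartAt_target (I := 𝓡 d) x) p hpt
  -- Hadamard's lemma needs a function smooth on the whole space; `f` read in the chart is smooth
  -- only on the target, so it is cut off inside it.
  let ψ : ContDiffBump p := ⟨r / 3, r / 2, by positivity, by linarith⟩
  have hψt : tsupport ψ ⊆ φ.target := by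
    rw [ψ.tsupport_eq]
    exact (Metric.closedBall_subset_ball (by simp [ψ]; linarith)).trans hrt
  let F : EuclideanSpace ℝ (Fin d) → ℝ := fun q => ψ q * f (φ.symm q)
  have hF : ContDiff ℝ ∞ F := by
    refine contMDiff_iff_contDiff.1 (contMDiff_of_tsupport fun q hq => ContDiffAt.contMDiffAt ?_)
    have hq' : q ∈ φ.target := hψt (tsupport_mul_subset_left hq)
    exact ψ.contDiff.contDiffAt.mul ((contDiffOn_comp_extChartAt_symm f).contDiffAt
      ((isOpen_extChartAt_target (I := 𝓡 d) x).mem_nhds hq'))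
  have hFf : F =ᶠ[𝓝 p] fun q => f (φ.symm q) := by
    filter_upwards [ψ.eventuallyEq_one] with q hq
    simp [F, hq]
  obtain ⟨G, hG, hGF, hGp⟩ := exists_contDiff_hadamard hF p
  let g : Fin d → C^∞⟮𝓡 d, M; ℝ⟯ := fun i =>
    chartFunction b (fun q => G q (EuclideanSpace.single i 1)) (hG.clm_apply contDiff_const)
  have hφc : ContinuousAt φ z := continuousAt_extChartAt' hzs
  have hloc : ⇑f =ᶠ[𝓝 z] ⇑(algebraMap ℝ C^∞⟮𝓡 d, M; ℝ⟯ (f z) +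
      ∑ i, g i * (chartCoord b i - algebraMap ℝ C^∞⟮𝓡 d, M; ℝ⟯ (p i))) := by
    filter_upwards [hz, hφc.eventually hFf, (isOpen_extChartAt_source (I := 𝓡 d) x).mem_nhds hzs]
      with y hy1 hy2 hy3
    have e1 : f y = F (φ y) := by rw [hy2, φ.left_inv hy3]
    have e2 : F p = f z := by rw [hFf.eq_of_nhds, hp, φ.left_inv hzs]
    have e3 : φ y - p = ∑ i, (φ y i - p i) • EuclideanSpace.single i (1 : ℝ) := by
      ext j
      simp [Pi.single_apply]
    have e4 : G (φ y) (φ y - p) =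
        ∑ i, (φ y i - p i) * G (φ y) (EuclideanSpace.single i (1 : ℝ)) := by
      conv_lhs => rw [e3]
      simp
    rw [e1, hGF, e2, e4]
    rw [ContMDiffMap.coe_add, Pi.add_apply, contMDiffMap_sum_apply]
    refine congrArg₂ _ rfl (Finset.sum_congr rfl fun i _ => ?_)
    simp only [ContMDiffMap.coe_mul, Pi.mul_apply, ContMDiffMap.coe_sub, Pi.sub_apply, g,
      chartCoord, chartFunction, bumpMul_apply, hy1, one_mul]
    rw [mul_comm]
    rfl
  rw [derivation_congr X hloc]
  simp only [map_add, map_sum, Derivation.map_algebraMap, zero_add, Derivation.leibniz, map_sub,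
    sub_zero]
  rw [contMDiffMap_sum_apply]
  refine Finset.sum_congr rfl fun i _ => ?_
  -- This kills the Leibniz terms containing `X (g i)`; `e6` identifies the coefficients that
  -- survive.
  have e5 : (chartCoord b i - algebraMap ℝ C^∞⟮𝓡 d, M; ℝ⟯ (p i)) z = 0 := by
    rw [ContMDiffMap.coe_sub, Pi.sub_apply]
    simp only [chartCoord, chartFunction, bumpMul_apply, hbz, one_mul]
    exact sub_self _
  have e6 : g i z = chartDerivation b (EuclideanSpace.single i 1) f z := by
    rw [chartDerivation_apply, ← hFf.fderiv_eq, ← hGp, hbz]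
    simp [g, chartFunction, hbz, hp, hφ]
  simp only [smul_eq_mul, ContMDiffMap.coe_add, Pi.add_apply, ContMDiffMap.coe_mul, Pi.mul_apply,
    e5, e6]
  ring

theorem chartDerivation_chartCoord (b : SmoothBumpFunction (𝓡 d) x) (i j : Fin d) :
    chartDerivation b (EuclideanSpace.single i 1) (chartCoord b j) x = if j = i then 1 else 0 := by
  rw [chartDerivation_apply, b.eq_one, one_mul]
  have h : (fun q => chartCoord b j ((extChartAt (𝓡 d) x).symm q)) =ᶠ[𝓝 (extChartAt (𝓡 d) x x)]
      fun q => (EuclideanSpace.proj j : EuclideanSpace ℝ (Fin d) →L[ℝ] ℝ) q := by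
    have hc : ContinuousAt (extChartAt (𝓡 d) x).symm (extChartAt (𝓡 d) x x) :=
      continuousAt_extChartAt_symm x
    have h1 : ∀ᶠ q in 𝓝 (extChartAt (𝓡 d) x x), b ((extChartAt (𝓡 d) x).symm q) = 1 := by
      refine hc.eventually (p := fun y => b y = 1) ?_
      rw [extChartAt_to_inv]
      exact b.eventuallyEq_one
    filter_upwards [h1, extChartAt_target_mem_nhds (I := 𝓡 d) x] with q hq1 hq2
    simp only [chartCoord, chartFunction, bumpMul_apply, hq1, one_mul,
      (extChartAt (𝓡 d) x).right_inv hq2]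
    rfl
  rw [h.fderiv_eq, ContinuousLinearMap.fderiv]
  simp

/-- Smooth manifolds have local frames: near every point the derivations are spanned by
derivations dual to some functions. -/
theorem exists_local_frame (x : M) :
    ∃ (e : Fin d → Derivation ℝ C^∞⟮𝓡 d, M; ℝ⟯ C^∞⟮𝓡 d, M; ℝ⟯) (y : Fin d → C^∞⟮𝓡 d, M; ℝ⟯)
      (c : C^∞⟮𝓡 d, M; ℝ⟯), c x = 1 ∧ (∀ i j, e i (y j) x = if j = i then 1 else 0) ∧
      ∀ X : Derivation ℝ C^∞⟮𝓡 d, M; ℝ⟯ C^∞⟮𝓡 d, M; ℝ⟯,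
        c • X = ∑ i, (c * X (y i)) • e i := by
  let b : SmoothBumpFunction (𝓡 d) x := Classical.arbitrary _
  -- Supporting `c` where `b` is locally 1 makes the expansion a global identity: off the support of
  -- `c` both sides vanish.
  have hb : {z | ∀ᶠ y in 𝓝 z, b y = 1} ∈ 𝓝 x := eventually_eventually_nhds.2 b.eventuallyEq_one
  obtain ⟨χ, -, hχ⟩ := (SmoothBumpFunction.nhds_basis_support (I := 𝓡 d) (c := x)
      Filter.univ_mem).mem_iff.1 hb
  obtain ⟨c, hc⟩ : ∃ c : C^∞⟮𝓡 d, M; ℝ⟯, ⇑c = χ := ⟨⟨χ, χ.contMDiff⟩, rfl⟩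
  refine ⟨fun i => chartDerivation b (EuclideanSpace.single i 1), chartCoord b,
    c, hc ▸ χ.eq_one, chartDerivation_chartCoord b, fun X => ?_⟩
  ext f z
  have hsum : ∀ D : Fin d → Derivation ℝ C^∞⟮𝓡 d, M; ℝ⟯ C^∞⟮𝓡 d, M; ℝ⟯,
      (∑ i, D i) f = ∑ i, D i f := fun D => by
    rw [← Derivation.coeFnAddMonoidHom_apply, map_sum, Finset.sum_apply]
    rfl
  rw [hsum, contMDiffMap_sum_apply]
  simp only [Derivation.smul_apply, smul_eq_mul, ContMDiffMap.coe_mul, Pi.mul_apply, mul_assoc]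
  rw [← Finset.mul_sum]
  by_cases hz : χ z = 0
  · simp [hc, hz]
  · rw [derivation_apply_eq_sum b X f (hχ hz)]

end LocalFrame

/-- A skew-symmetric form of degree two, as a linear map to the dual module. -/
def formToDual {A G : Type*} [CommRing A] [AddCommGroup G] [Module A G] (Ω : G [⋀^Fin 2]→ₗ[A] A) :
    G →ₗ[A] Module.Dual A G where
  toFun φ := (AlternatingMap.ofSubsingleton A G A (0 : Fin 1)).symm (Ω.curryLeft φ)
  map_add' φ ψ := by
    rw [map_add]
    rfl
  map_smul' a φ := by
    rw [map_smul]
    rfl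

theorem formToDual_apply {A G : Type*} [CommRing A] [AddCommGroup G] [Module A G]
    (Ω : G [⋀^Fin 2]→ₗ[A] A) (φ ψ : G) : formToDual Ω φ ψ = Ω ![φ, ψ] := by
  refine congrArg Ω ?_
  funext i
  fin_cases i <;> rfl

/-! ### Local frames of first-order operators. -/

section DiffOpFrame

variable {d : ℕ} {M : Type*} [TopologicalSpace M]
  [ChartedSpace (EuclideanSpace ℝ (Fin d)) M]

/-- The coefficient of order zero of a differential operator of order `≤ 1`. -/
def DiffOp.constCoeff {K A : Type*} [Field K] [CommRing A] [Algebra K A] :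
    DiffOp K A →ₗ[A] A where
  toFun φ := (φ : Module.End K A) 1
  map_add' _ _ := rfl
  map_smul' _ _ := rfl

/-- The value on `y` of the derivation `φ - φ(1)`. -/
def DiffOp.symbolAt {K A : Type*} [Field K] [CommRing A] [Algebra K A] (y : A) :
    DiffOp K A →ₗ[A] A where
  toFun φ := (φ : Module.End K A) y - y * (φ : Module.End K A) 1
  map_add' φ ψ := by
    simp only [Submodule.coe_add, LinearMap.add_apply]
    ring
  map_smul' a φ := by
    simp only [Submodule.coe_smul, LinearMap.smul_apply, smul_eq_mul, RingHom.id_apply]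
    ring

/-- The derivation `φ - φ(1)` attached to a differential operator `φ` of order `≤ 1`. -/
def DiffOp.toDerivation {K A : Type*} [Field K] [CommRing A] [Algebra K A] (φ : DiffOp K A) :
    Derivation K A A :=
  Derivation.mk' ((φ : Module.End K A) - LinearMap.mulRight K ((φ : Module.End K A) 1))
    fun f g => by
      have h : (φ : Module.End K A) (f * g) = _ := φ.2 f g
      simp only [LinearMap.sub_apply, LinearMap.mulRight_apply, h, smul_eq_mul]
      ring

theorem DiffOp.eq_add {K A : Type*} [Field K] [CommRing A] [Algebra K A] (φ : DiffOp K A) :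
    φ = DiffOp.constCoeff φ • DiffOp.ofFun 1 + DiffOp.ofDerivation (DiffOp.toDerivation φ) := by
  refine Subtype.ext (LinearMap.ext fun f => ?_)
  change (φ : Module.End K A) f = (φ : Module.End K A) 1 * (1 * f) +
    ((φ : Module.End K A) f - f * (φ : Module.End K A) 1)
  ring

/-- Since `φ` is `φ(1)` plus a derivation, the operator 1 completes a frame of derivations. Its dual
forms are `constCoeff` and the `symbolAt (y i)`, which vanish on 1. -/
theorem exists_diffOp_frame [T2Space M] [IsManifold (𝓡 d) ∞ M] (x : M) :
    ∃ (E : Fin d → Derivation ℝ C^∞⟮𝓡 d, M; ℝ⟯ C^∞⟮𝓡 d, M; ℝ⟯)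
      (ε : Fin (d + 1) → Module.Dual C^∞⟮𝓡 d, M; ℝ⟯ (DiffOp ℝ C^∞⟮𝓡 d, M; ℝ⟯))
      (c : C^∞⟮𝓡 d, M; ℝ⟯), c x = 1 ∧
      (∀ a b, ε a ((Fin.cons (DiffOp.ofFun 1) fun i => DiffOp.ofDerivation (E i) :
        Fin (d + 1) → DiffOp ℝ C^∞⟮𝓡 d, M; ℝ⟯) b) x = if a = b then 1 else 0) ∧
      ∀ φ, c • φ = ∑ a, (c * ε a φ) • (Fin.cons (DiffOp.ofFun 1)
        fun i => DiffOp.ofDerivation (E i) : Fin (d + 1) → DiffOp ℝ C^∞⟮𝓡 d, M; ℝ⟯) a := by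
  obtain ⟨E, y, c, hc, hEy, hX⟩ := exists_local_frame (d := d) x
  refine ⟨E, Fin.cons DiffOp.constCoeff fun i => DiffOp.symbolAt (y i), c, hc, ?_, fun φ => ?_⟩
  · intro a b
    refine Fin.cases ?_ (fun a => ?_) a <;> refine Fin.cases ?_ (fun b => ?_) b
    · simp only [Fin.cons_zero, if_true]
      change ((1 : C^∞⟮𝓡 d, M; ℝ⟯) * 1) x = 1
      rw [mul_one]
      rfl
    · rw [if_neg (Fin.succ_ne_zero b).symm]
      change (E b 1) x = 0
      rw [Derivation.map_one_eq_zero]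
      rfl
    · rw [if_neg (Fin.succ_ne_zero a)]
      change ((1 : C^∞⟮𝓡 d, M; ℝ⟯) * y a - y a * ((1 : C^∞⟮𝓡 d, M; ℝ⟯) * 1)) x = 0
      rw [one_mul, mul_one, mul_one, sub_self]
      rfl
    · change (E b (y a) - y a * E b 1) x = _
      rw [Derivation.map_one_eq_zero, mul_zero, sub_zero, hEy]
      simp
  · rw [Fin.sum_univ_succ]
    simp only [Fin.cons_zero, Fin.cons_succ]
    conv_lhs => rw [DiffOp.eq_add φ, smul_add, smul_smul,
      ← LinearMap.map_smul DiffOp.ofDerivation, hX, map_sum]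
    simp only [LinearMap.map_smul]
    rfl

end DiffOpFrame

/-! ### Evaluation at a point and the volume form. -/

/-- Pointwise form of the main result: `D` is a module with a local frame `u, ι(E₀), …, ι(E₂ₙ)` at
the point `ev`, and `Ω` is a nondegenerate 2-form on `D`. -/
theorem exists_map_wedge_wedgePow_ne_zero {A D T : Type*} [CommRing A] [Algebra ℝ A]
    [AddCommGroup D] [Module A D] [AddCommGroup T] [Module A T] (ι : T →ₗ[A] D) (ev : A →+* ℝ)
    (hevc : ∀ r : ℝ, ev (algebraMap ℝ A r) = r) (n : ℕ) (Ω : D [⋀^Fin 2]→ₗ[A] A)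
    (hΩ : Function.Surjective (formToDual Ω)) (u : D) (E : Fin (2 * n + 1) → T)
    (ε : Fin (2 * n + 1 + 1) → Module.Dual A D) (c : A) (hc : ev c = 1)
    (hε : ∀ a b, ev (ε a ((Fin.cons u fun i => ι (E i) : Fin (2 * n + 1 + 1) → D) b)) =
      if a = b then 1 else 0)
    (hφ : ∀ φ, c • φ = ∑ a, (c * ε a φ) •
      (Fin.cons u fun i => ι (E i) : Fin (2 * n + 1 + 1) → D) a) :
    ∃ X, ev (wedge ((Ω.curryLeft u).compLinearMap ι) (wedgePow (Ω.compLinearMap ι) n) X) ≠ 0 := by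
  set e : Fin (2 * n + 1 + 1) → D := Fin.cons u fun i => ι (E i)
  let β := formToDual Ω
  have hβ : ∀ φ ψ, β φ ψ = Ω ![φ, ψ] := formToDual_apply Ω
  -- Fibre vectors are lifted with constant coefficients; `vf` also drops the `u` component, so its
  -- values lie in `T`.
  let vec : (Fin (2 * n + 1 + 1) → ℝ) → D := fun v => ∑ a, algebraMap ℝ A (v a) • e a
  let vf : (Fin (2 * n + 1 + 1) → ℝ) → T :=
    fun v => ∑ i : Fin (2 * n + 1), algebraMap ℝ A (v i.succ) • E i
  have hvec_add : ∀ v w, vec (v + w) = vec v + vec w := fun v w => by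
    simp [vec, add_smul, Finset.sum_add_distrib]
  have hvec_smul : ∀ (r : ℝ) v, vec (r • v) = algebraMap ℝ A r • vec v := fun r v => by
    simp only [vec, Finset.smul_sum, smul_smul, Pi.smul_apply, smul_eq_mul, map_mul]
  have hvf : ∀ v, ι (vf v) = vec v - algebraMap ℝ A (v 0) • e 0 := fun v => by
    simp only [vf, vec, map_sum, map_smul]
    rw [Fin.sum_univ_succ (n := 2 * n + 1), add_sub_cancel_left]
    rfl
  let B : (Fin (2 * n + 1 + 1) → ℝ) →ₗ[ℝ] (Fin (2 * n + 1 + 1) → ℝ) →ₗ[ℝ] ℝ :=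
    LinearMap.mk₂ ℝ (fun v w => ev (β (vec v) (vec w)))
      (fun v v' w => by simp [hvec_add])
      (fun r v w => by
        simp only [hvec_smul, map_smul, LinearMap.smul_apply, smul_eq_mul, map_mul, hevc])
      (fun v w w' => by simp [hvec_add])
      (fun r v w => by simp only [hvec_smul, map_smul, smul_eq_mul, map_mul, hevc])
  have hB : ∀ v w, B v w = ev (β (vec v) (vec w)) := fun v w => rfl
  have hBalt : B.IsAlt := fun v => by
    rw [hB, hβ, Ω.map_eq_zero_of_eq _ (i := 0) (j := 1) rfl (by decide), map_zero]
  have hexpand : ∀ φ ψ, ev (β φ ψ) = ∑ a, ev (ε a φ) * ev (β (e a) ψ) := by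
    intro φ ψ
    have h1 := congrArg (fun χ => ev (β χ ψ)) (hφ φ)
    simpa [hc, mul_assoc] using h1
  have hBnondeg : ∀ v, (∀ w, B v w = 0) → v = 0 := by
    intro v hv
    funext a
    -- The coordinate form `ε a` is `i_φ Ω`, so the coordinate `v a` is a pairing of `v` under `B`
    -- and vanishes when `v` is in the radical.
    obtain ⟨φ, hφa⟩ := hΩ (ε a)
    have h1 : B (fun b => ev (ε b φ)) v = v a := by
      have h2 : B (fun b => ev (ε b φ)) v = ev (β φ (vec v)) := by
        rw [hexpand φ, hB]
        simp only [vec, map_sum β, map_smul, LinearMap.sum_apply, LinearMap.smul_apply,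
          smul_eq_mul, map_mul, map_sum ev, hevc]
      rw [h2, hφa]
      simp only [vec, map_sum, map_smul, smul_eq_mul, map_mul, hevc, hε]
      simp
    rw [← h1, ← hBalt.neg, hv, neg_zero]
    rfl
  have he0 : vec (Pi.single 0 1) = e 0 := by
    simp only [vec]
    rw [Finset.sum_eq_single 0 (fun b _ hb => by simp [hb]) (by simp)]
    simp
  obtain ⟨w, v, hw, hv, -, hvv⟩ := exists_symplectic_basis n B hBalt hBnondeg
    (by simp) (Pi.single 0 1) (by simp)
  have hθ : ∀ z, ev ((Ω.curryLeft u).compLinearMap ι ![vf z]) =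
      B (Pi.single 0 1) z := by
    intro z
    have h1 : (Ω.curryLeft u).compLinearMap ι ![vf z] =
        β (e 0) (ι (vf z)) := by
      rw [hβ]
      refine congrArg Ω ?_
      funext i
      fin_cases i <;> rfl
    have h2 : β (e 0) (e 0) = 0 := by
      rw [hβ, Ω.map_eq_zero_of_eq _ (i := 0) (j := 1) rfl (by decide)]
    rw [h1, hvf, hB, he0]
    simp [h2]
  -- Orthogonality to `u` is what makes dropping the `u` components harmless here.
  have hω : ∀ y z, B (Pi.single 0 1) y = 0 → B (Pi.single 0 1) z = 0 →
      ev (Ω.compLinearMap ι ![vf y, vf z]) = B y z := by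
    intro y z hy hz
    have h1 : Ω.compLinearMap ι ![vf y, vf z] =
        β (ι (vf y)) (ι (vf z)) := by
      rw [hβ]
      refine congrArg Ω ?_
      funext i
      fin_cases i <;> rfl
    have hy' : B y (Pi.single 0 1) = 0 := by rw [← hBalt.neg, hy, neg_zero]
    have h00 := hBalt (Pi.single 0 1)
    rw [hB, he0] at hy hz hy' h00
    rw [h1, hvf, hvf, hB]
    simp only [map_sub, map_smul, LinearMap.sub_apply, LinearMap.smul_apply, smul_eq_mul, map_mul,
      hevc, hz, hy', h00]
    simp
  have key := map_wedge_wedgePow ev ((Ω.curryLeft u).compLinearMap ι)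
    (Ω.compLinearMap ι) n (vf w) (fun i => vf (v i)) ((hθ w).trans hw)
    fun i => (hθ (v i)).trans (hv i)
  refine ⟨fun i => (Fin.cons (vf w) fun i => vf (v i) : Fin (2 * n + 1) → T)
    (Fin.cast (Nat.add_comm _ _) i), fun h0 => (pfaffianSum_stdSymplectic_pos n).ne ?_⟩
  rw [h0, mul_zero] at key
  rw [key]
  congr 1
  funext a b
  rw [hω _ _ (hv a) (hv b), hvv]

theorem theorem12 (n : ℕ) {M : Type*} [TopologicalSpace M] [T2Space M] [ParacompactSpace M]
    [ConnectedSpace M] [ChartedSpace (EuclideanSpace ℝ (Fin (2 * n + 1))) M]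
    [IsManifold (𝓡 (2 * n + 1)) ∞ M]
    (α : DiffOp ℝ C^∞⟮𝓡 (2 * n + 1), M; ℝ⟯ →ₗ[C^∞⟮𝓡 (2 * n + 1), M; ℝ⟯]
      C^∞⟮𝓡 (2 * n + 1), M; ℝ⟯)
    (Ω : DiffOp ℝ C^∞⟮𝓡 (2 * n + 1), M; ℝ⟯ [⋀^Fin 2]→ₗ[C^∞⟮𝓡 (2 * n + 1), M; ℝ⟯]
      C^∞⟮𝓡 (2 * n + 1), M; ℝ⟯)
    (h : IsSymplecticLieRinehartJacobi (rhoOf α) Ω) :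
    IsVolumeForm
      (wedge (restrictToVectorFields (interiorProd (DiffOp.ofFun 1) Ω))
        (wedgePow (restrictToVectorFields Ω) n)) := by
  refine ⟨Nat.add_comm _ _, fun x => ?_⟩
  obtain ⟨E, ε, c, hc, hε, hφ⟩ := exists_diffOp_frame (d := 2 * n + 1) x
  exact exists_map_wedge_wedgePow_ne_zero DiffOp.ofDerivation (ContMDiffMap.evalRingHom x)
    (fun _ => rfl) n Ω h.nondegenerate.2 (DiffOp.ofFun 1) E ε c hc hε hφ

end
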